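/- There is a universal constant $C>0$ such that the following holds for all integers $0\le k\le n$ and all $\varepsilon\in(0,1)$. There is a quantum query algorithm, depending only on $k,n,\varepsilon$, which makes at most $C/\varepsilon$ queries in total to controlled-$U$, controlled-$U^\dagger$, controlled-$V$ and controlled-$V^\dagger$, and has the following property. Let $U$ and $V$ be any unitary operators on $n$ qubits, split into a system $\mathsf A$ of $k$ qubits and a system $\mathsf B$ of $n-k$ qubits, and suppose that they prepare purifications of the $k$-qubit mixed states $\rho$ and $\sigma$, i.e. $$\rho=\operatorname{tr}_{\mathsf B}\bigl(|\rho\rangle\langle\rho|\bigr),\quad |\rho\rangle=U|0\rangle_{\mathsf A}|0\rangle_{\mathsf B},\qquad \sigma=\operatorname{tr}_{\mathsf B}\bigl(|\sigma\rangle\langle\sigma|\bigr),\quad |\sigma\rangle=V|0\rangle_{\mathsf A}|0\rangle_{\mathsf B}.$$ Then, run with oracles $U$ and $V$, the algorithm outputs a real number $\tilde x$ with $$\Pr\Bigl[\,\bigl|\tilde x-\sqrt{\operatorname{tr}(\rho\sigma^2)}\bigr|<\varepsilon\Bigr]\ \ge\ \tfrac23 .$$ Here a quantum query algorithm is a finite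 sequence of steps on a finite register of qubits initialized to the all-zero state, each step being either a fixed unitary gate that does not depend on $U$ and $V$, or one query to one of the four controlled oracles; at the end the register is measured in the computational basis and a fixed classical function of the outcome is returned. -/

import Mathlib

open scoped Kronecker

noncomputable section

namespace QueryModel

/-- Computational basis labels (bit strings) of a register of `m` qubits. -/
abbrev Qubits (m : ℕ) : Type := Fin m → Bool

/-- The all-zero bit string. -/
def zeros (m : ℕ) : Qubits m := fun _ => false

/-- The basis vector `|i⟩` of the space `ℂ^ι`. -/
def ket {ι : Type} [DecidableEq ι] (i : ι) : ι → ℂ := Pi.single i 1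

/-- Partial trace over the second subsystem of an operator on `A ⊗ B`. -/
def partialTrace {A B : Type} [Fintype B] (M : Matrix (A × B) (A × B) ℂ) : Matrix A A ℂ :=
  fun a a' => ∑ x : B, M (a, x) (a', x)

/-- The rank-one operator `|ψ⟩⟨ψ|`. -/
def outer {ι : Type} (ψ : ι → ℂ) : Matrix ι ι ℂ := Matrix.vecMulVec ψ (star ψ)

/-- Labels of a system `AB`, where `A` has `k` qubits and `B` has `b` qubits. -/
abbrev Reg (k b : ℕ) : Type := Qubits k × Qubits b

/-- Unitary operators on the `(k + b)`-qubit system `AB`. -/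
abbrev Oracle (k b : ℕ) : Type := Matrix.unitaryGroup (Reg k b) ℂ

/-- `U` prepares a purification of `ρ`: the state `U |0⟩_A |0⟩_B` satisfies
`ρ = tr_B (U |0⟩⟨0| U†)`. -/
def PreparesPurification {k b : ℕ} (U : Oracle k b)
    (ρ : Matrix (Qubits k) (Qubits k) ℂ) : Prop :=
  ρ = partialTrace (outer ((U : Matrix (Reg k b) (Reg k b) ℂ).mulVec (ket (zeros k, zeros b))))

/-- Labels of the whole memory of a query algorithm: the `(k + b)`-qubit query register,
the control qubit and `m` work qubits. -/
abbrev Memory (k b m : ℕ) : Type := (Reg k b × Bool) × Qubits m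

/-- The four oracles that can be queried (always in controlled form):
`U`, `U†`, `V`, `V†`. -/
inductive Query : Type
  | U
  | Uinv
  | V
  | Vinv

/-- The unitary operator on `AB` named by a query. -/
def Query.eval {k b : ℕ} (U V : Oracle k b) : Query → Oracle k b
  | .U => U
  | .Uinv => U⁻¹
  | .V => V
  | .Vinv => V⁻¹

/-- The controlled operator `M ⊗ |1⟩⟨1| + I ⊗ |0⟩⟨0|`; the last factor is the control qubit. -/
def controlled {ι : Type} [DecidableEq ι] (M : Matrix ι ι ℂ) : Matrix (ι × Bool) (ι × Bool) ℂ :=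
  Matrix.blockDiagonal (fun c : Bool => if c then M else 1)

/-- One step of an algorithm: a unitary gate on the whole memory, fixed independently of the
oracles, or one query. -/
inductive Step (k b m : ℕ) : Type
  | gate (G : Matrix.unitaryGroup (Memory k b m) ℂ)
  | query (q : Query)

/-- The operator on the memory performed by a step. A query applies the controlled oracle to
the query register and the control qubit, and the identity to the work qubits. An uncontrolled
query is the same thing with the control qubit in state `|1⟩`. -/
def Step.eval {k b m : ℕ} (U V : Oracle k b) :
    Step k b m → Matrix (Memory k b m) (Memory k b m) ℂ
  | .gate G => G
  | .query q => controlled (q.eval U V : Matrix (Reg k b) (Reg k b) ℂ) ⊗ₖ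
      (1 : Matrix (Qubits m) (Qubits m) ℂ)

/-- The number of queries made by a step. -/
def Step.cost {k b m : ℕ} : Step k b m → ℕ
  | .gate _ => 0
  | .query _ => 1

/-- A quantum query algorithm with access to two unitary oracles on `k + b` qubits: a number of
work qubits, a finite sequence of steps, and a classical post-processing function that turns the
outcome of the final measurement in the computational basis into a real number. -/
structure QueryAlgorithm (k b : ℕ) : Type where
  work : ℕ
  steps : List (Step k b work)
  output : Memory k b work → ℝ

namespace QueryAlgorithm

variable {k b : ℕ}

/-- The total number of queries (to controlled-`U`, controlled-`V` and their inverses). -/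
def queryCount (𝒜 : QueryAlgorithm k b) : ℕ := (𝒜.steps.map Step.cost).sum

/-- The state of the memory after all steps (performed from the head of the list on), started
in the all-zero state. -/
def finalState (𝒜 : QueryAlgorithm k b) (U V : Oracle k b) : Memory k b 𝒜.work → ℂ :=
  𝒜.steps.foldl (fun ψ s => (s.eval U V).mulVec ψ)
    (ket (((zeros k, zeros b), false), zeros 𝒜.work))

/-- The probability that the number returned by the algorithm lies in `S`: the memory is
measured in the computational basis (Born rule) and the outcome is post-processed. -/
def prob (𝒜 : QueryAlgorithm k b) (U V : Oracle k b) (S : Set ℝ) : ℝ :=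
  ∑ x : Memory k b 𝒜.work, (𝒜.output ⁻¹' S).indicator (fun x => ‖𝒜.finalState U V x‖ ^ 2) x

end QueryAlgorithm

end QueryModel

end

open scoped Kronecker

noncomputable section

/-! Put |σ⟩ and |ρ⟩ side by side, exchange their `A` parts, and undo `V` on the first register. The
component at label zero of that register is σ|ρ⟩, whose squared norm is tr(σρσ) = tr(ρσ²)
(`l2Sq_restrictTo_prepState`). This takes three queries, so what remains is to estimate the
amplitude a = √tr(ρσ²), not its square, to precision ε.

Amplitude estimation is done without a Fourier transform. Let s be the prepared state, l its
normalized good part, and P, B the reflections about the good subspace and about s. Then (P + B)s =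
2a l and (P + B)l = 2a s (`exists_good_vector`). As P and B are involutions, the alternating orbits
χ of s and ξ of l combine into w = χ ± ξ with w(n+2) + w(n) = ±2a w(n+1) (`alternate_three_term`).
Up to boundary terms, such a sequence is an eigenvector of half the adjacency matrix of a path, with
eigenvalue ±a. A slowly varying window vanishing at both ends removes the boundary terms and costs a
squared error O(1/L²) (`sum_l2Sq_halfPath_sub_le`).

The circuit prepares the windowed χ, the mean of the two approximate eigenvectors, measures the
counter in an eigenbasis of the path, and returns the absolute eigenvalue. Its mean squared
deviation from a is O(1/L²), and Chebyshev's inequality with L of order 1/ε finishes the proof. -/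

namespace QueryModel

open Matrix

set_option synthInstance.maxSize 1000

/-! ### Norms of vectors and unitary matrices. -/

section Analysis

/-- The squared Euclidean norm of a vector. -/
def l2Sq {ι : Type} [Fintype ι] (v : ι → ℂ) : ℝ := ∑ x, ‖v x‖ ^ 2

variable {ι K : Type} [Fintype ι]

lemma star_dotProduct_self (v : ι → ℂ) : star v ⬝ᵥ v = (l2Sq v : ℂ) := by
  simp [dotProduct, l2Sq, Complex.conj_mul']

lemma l2Sq_mulVec [DecidableEq ι] (U : unitaryGroup ι ℂ) (v : ι → ℂ) :
    l2Sq ((U : Matrix ι ι ℂ) *ᵥ v) = l2Sq v := by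
  have h : ((l2Sq ((U : Matrix ι ι ℂ) *ᵥ v) : ℝ) : ℂ) = (l2Sq v : ℂ) := by
    rw [← star_dotProduct_self, ← star_dotProduct_self, star_mulVec, dotProduct_mulVec,
      vecMul_vecMul, ← star_eq_conjTranspose, UnitaryGroup.star_mul_self, vecMul_one]
  exact_mod_cast h

lemma l2Sq_smul (c : ℂ) (v : ι → ℂ) : l2Sq (c • v) = ‖c‖ ^ 2 * l2Sq v := by
  simp [l2Sq, mul_pow, Finset.mul_sum]

lemma sq_norm_add_le (z w : ℂ) : ‖z + w‖ ^ 2 ≤ 2 * (‖z‖ ^ 2 + ‖w‖ ^ 2) := by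
  nlinarith [norm_add_le z w, sq_nonneg (‖z‖ - ‖w‖), norm_nonneg (z + w), norm_nonneg z,
    norm_nonneg w]

lemma l2Sq_add_le (v w : ι → ℂ) : l2Sq (v + w) ≤ 2 * (l2Sq v + l2Sq w) := by
  simp only [l2Sq, ← Finset.sum_add_distrib, Finset.mul_sum]
  exact Finset.sum_le_sum fun x _ => sq_norm_add_le _ _

/-- Each column of `Y` is mapped by `U` isometrically; the sums over rows and columns commute. -/
lemma sum_l2Sq_mul [Fintype K] [DecidableEq ι] (U : unitaryGroup ι ℂ) (Y : Matrix ι K ℂ) :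
    ∑ i, l2Sq (((U : Matrix ι ι ℂ) * Y) i) = ∑ i, l2Sq (Y i) := by
  simp only [l2Sq]
  rw [Finset.sum_comm, Finset.sum_comm (f := fun i x => ‖Y i x‖ ^ 2)]
  refine Finset.sum_congr rfl fun x _ => ?_
  exact l2Sq_mulVec U (fun i => Y i x)

/-- There is a unitary matrix with a prescribed unit vector as one of its columns. -/
lemma exists_unitary_mulVec_ket [DecidableEq ι] (i : ι) (v : ι → ℂ) (hv : l2Sq v = 1) :
    ∃ G : unitaryGroup ι ℂ, (G : Matrix ι ι ℂ) *ᵥ ket i = v := by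
  have hn : ‖(WithLp.toLp 2 v : EuclideanSpace ℂ ι)‖ = 1 := by
    rw [EuclideanSpace.norm_eq]
    simpa [l2Sq] using hv
  -- A constant family is orthonormal on the single index `i`, so it extends to a basis whose `i`-th
  -- vector is `v`.
  have ho : Orthonormal ℂ (Set.domRestrict {i}
      (fun _ : ι => (WithLp.toLp 2 v : EuclideanSpace ℂ ι))) := by
    constructor
    · intro _; exact hn
    · intro a b hab
      exact absurd (Subsingleton.elim a b) hab
  obtain ⟨b, hb⟩ := ho.exists_orthonormalBasis_extension_of_card_eq (by simp)
  refine ⟨⟨(EuclideanSpace.basisFun ι ℂ).toBasis.toMatrix b,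
    (EuclideanSpace.basisFun ι ℂ).toMatrix_orthonormalBasis_mem_unitary b⟩, ?_⟩
  ext x
  simp [ket, Module.Basis.toMatrix_apply, hb i (Set.mem_singleton i)]

/-! ### Alternating orbits of two involutions. -/

/-- The alternating orbit `s, P s, B P s, P B P s, …`. -/
def alternate [Fintype K] [DecidableEq K] (P B : unitaryGroup K ℂ) (s : K → ℂ) : ℕ → K → ℂ
  | 0 => s
  | n + 1 => ((if Even n then P else B : unitaryGroup K ℂ) : Matrix K K ℂ) *ᵥ alternate P B s n

lemma l2Sq_alternate [Fintype K] [DecidableEq K] (P B : unitaryGroup K ℂ) (s : K → ℂ) (n : ℕ) :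
    l2Sq (alternate P B s n) = l2Sq s := by
  induction n with
  | zero => rfl
  | succ n ih => rw [alternate, l2Sq_mulVec, ih]

lemma coe_mul_coe_of_sq [Fintype K] [DecidableEq K] {P : unitaryGroup K ℂ} (hP : P * P = 1) :
    (P : Matrix K K ℂ) * (P : Matrix K K ℂ) = 1 := by
  have := congrArg Subtype.val hP
  simpa using this

/-- Since P² = B² = 1, both (P + B)P = B(P + B) and (P + B)B = P(P + B): moving P + B through the
orbit exchanges the two letters. -/
lemma add_mulVec_alternate [Fintype K] [DecidableEq K] {P B : unitaryGroup K ℂ} (hP : P * P = 1) (hB : B * B = 1)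
    {s l : K → ℂ} {c : ℂ} (h : (P + B : Matrix K K ℂ) *ᵥ s = c • l) (n : ℕ) :
    (P + B : Matrix K K ℂ) *ᵥ alternate P B s n = c • alternate B P l n := by
  have hP' := coe_mul_coe_of_sq hP
  have hB' := coe_mul_coe_of_sq hB
  induction n with
  | zero => exact h
  | succ n ih =>
    simp only [alternate]
    have h1 : (P + B : Matrix K K ℂ) * (P : Matrix K K ℂ) = (B : Matrix K K ℂ) * (P + B) := by
      rw [add_mul, mul_add, hP', hB', add_comm]
    have h2 : (P + B : Matrix K K ℂ) * (B : Matrix K K ℂ) = (P : Matrix K K ℂ) * (P + B) := by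
      rw [add_mul, mul_add, hP', hB', add_comm]
    split_ifs
    · rw [mulVec_mulVec, h1, ← mulVec_mulVec, ih, mulVec_smul]
    · rw [mulVec_mulVec, h2, ← mulVec_mulVec, ih, mulVec_smul]

/-- From term n + 1, one of P and B leads forward to term n + 2 and the other, being an involution,
leads back to term n. -/
lemma alternate_add_two [Fintype K] [DecidableEq K] {P B : unitaryGroup K ℂ} (hP : P * P = 1) (hB : B * B = 1)
    (s : K → ℂ) (n : ℕ) :
    alternate P B s (n + 2) + alternate P B s n
      = (P + B : Matrix K K ℂ) *ᵥ alternate P B s (n + 1) := by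
  have hP' := coe_mul_coe_of_sq hP
  have hB' := coe_mul_coe_of_sq hB
  by_cases hn : Even n
  · have hn1 : ¬ Even (n + 1) := by simpa [Nat.even_add_one] using hn
    simp [alternate, hn, hn1, add_mul, hP', add_mulVec, add_comm]
  · have hn1 : Even (n + 1) := by simpa [Nat.even_add_one] using hn
    simp [alternate, hn, hn1, add_mul, hB', add_mulVec, add_comm]

/-- The two orbits drive each other; taking their sum (t = 1) or difference (t = -1) decouples them
into Chebyshev recurrences. -/
lemma alternate_three_term [Fintype K] [DecidableEq K] {P B : unitaryGroup K ℂ} (hP : P * P = 1) (hB : B * B = 1)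
    {s l : K → ℂ} {a t : ℝ} (hs : (P + B : Matrix K K ℂ) *ᵥ s = (2 * a : ℂ) • l)
    (hl : (P + B : Matrix K K ℂ) *ᵥ l = (2 * a : ℂ) • s) (ht : t * t = 1) (n : ℕ) :
    (alternate P B s (n + 2) + (t : ℂ) • alternate B P l (n + 2))
      + (alternate P B s n + (t : ℂ) • alternate B P l n)
      = (2 * (t * a : ℝ) : ℂ) •
        (alternate P B s (n + 1) + (t : ℂ) • alternate B P l (n + 1)) := by
  have h1 := alternate_add_two hP hB s n
  have h2 := alternate_add_two hB hP l n
  rw [add_mulVec_alternate hP hB hs] at h1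
  rw [add_mulVec_alternate hB hP (by rw [add_comm]; exact hl)] at h2
  have ht' : (t : ℂ) * t = 1 := by exact_mod_cast ht
  have h3 : (alternate P B s (n + 2) + (t : ℂ) • alternate B P l (n + 2))
      + (alternate P B s n + (t : ℂ) • alternate B P l n)
      = (alternate P B s (n + 2) + alternate P B s n)
        + (t : ℂ) • (alternate B P l (n + 2) + alternate B P l n) := by
    rw [smul_add]; abel
  rw [h3, h1, h2]
  ext x
  simp only [Pi.add_apply, Pi.smul_apply, smul_eq_mul, Complex.ofReal_mul]
  linear_combination (-2 * (a : ℂ) * alternate B P l (n + 1) x) * ht'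

/-! ### The path matrix and its approximate eigenvectors. -/

/-- Half the adjacency matrix of the path on `N` vertices. -/
def halfPath (N : ℕ) : Matrix (Fin N) (Fin N) ℂ :=
  fun i j => (1 / 2) *
    ((if (j : ℕ) = i + 1 then 1 else 0) + (if (i : ℕ) = j + 1 then 1 else 0))

lemma halfPath_isHermitian (N : ℕ) : (halfPath N).IsHermitian := by
  ext i j
  rw [conjTranspose_apply, halfPath, halfPath, add_comm]
  split_ifs <;> simp

/-- The matrix with rows `α j • w j`. -/
def weighted (N : ℕ) (α : ℕ → ℝ) (w : ℕ → K → ℂ) : Matrix (Fin N) K ℂ :=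
  fun j => (α j : ℂ) • w j

lemma halfPath_mul_weighted {N : ℕ} {α : ℕ → ℝ} (hN : α N = 0) (w : ℕ → K → ℂ) (j : Fin N) :
    (halfPath N * weighted N α w) j = (1 / 2 : ℂ) • ((α (j + 1) : ℂ) • w (j + 1)
      + if (j : ℕ) = 0 then 0 else (α (j - 1) : ℂ) • w (j - 1)) := by
  ext x
  simp only [mul_apply, halfPath, weighted, mul_assoc, add_mul, ← Finset.mul_sum,
    Finset.sum_add_distrib, Pi.smul_apply, Pi.add_apply, smul_eq_mul, ite_mul, one_mul, zero_mul]
  congr 2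
  · by_cases hj : (j : ℕ) + 1 < N
    · rw [Finset.sum_eq_single (⟨j + 1, hj⟩ : Fin N)]
      · simp
      · intro i _ hi
        rw [if_neg]
        exact fun h => hi (Fin.ext h)
      · simp
    · have : (j : ℕ) + 1 = N := by omega
      rw [this, hN, Finset.sum_eq_zero]
      · simp
      · intro i _
        rw [if_neg]
        omega
  · by_cases hj : (j : ℕ) = 0
    · simp [hj]
    · rw [Finset.sum_eq_single (⟨j - 1, by omega⟩ : Fin N)]
      · have : (j : ℕ) = j - 1 + 1 := by omega
        simp [hj, ← this]
      · intro i _ hi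
        rw [if_neg]
        exact fun h => hi (Fin.ext (by simp; omega))
      · simp

/-- By the recurrence for `w`, each row of the residual contains only differences of neighbouring
weights. -/
lemma sum_l2Sq_halfPath_sub_le [Fintype K] {N : ℕ} {α : ℕ → ℝ} {δ : ℝ} (h0 : α 0 = 0) (hN : α N = 0)
    (hα : ∀ n, |α (n + 1) - α n| ≤ δ) {w : ℕ → K → ℂ} {c : ℝ}
    (hw : ∀ n, w (n + 2) + w n = (2 * c : ℂ) • w (n + 1)) (hb : ∀ n, l2Sq (w n) ≤ 4) :
    ∑ j, l2Sq ((halfPath N * weighted N α w - (c : ℂ) • weighted N α w) j)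
      ≤ N * (4 * δ ^ 2) := by
  have hterm (d : ℝ) (hd : |d| ≤ δ) (n : ℕ) : l2Sq ((d : ℂ) • w n) ≤ 4 * δ ^ 2 := by
    rw [l2Sq_smul, Complex.norm_real, Real.norm_eq_abs]
    have h1 : |d| ^ 2 ≤ δ ^ 2 := by gcongr
    have h2 : 0 ≤ l2Sq (w n) := Finset.sum_nonneg fun _ _ => by positivity
    nlinarith [hb n, sq_nonneg δ]
  have hrow (j : Fin N) :
      l2Sq ((halfPath N * weighted N α w - (c : ℂ) • weighted N α w) j) ≤ 4 * δ ^ 2 := by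
    change l2Sq ((halfPath N * weighted N α w) j - ((c : ℂ) • weighted N α w) j) ≤ _
    rw [halfPath_mul_weighted hN]
    rcases Nat.eq_zero_or_pos (j : ℕ) with hj | hj
    -- Vertex 0 has no left neighbour; `α 0 = 0` removes the eigenvalue term and lets α 1 count as a
    -- difference.
    · have h1 := hterm (α 1 - α 0) (hα 0) 1
      have : (1 / 2 : ℂ) • ((α (j + 1) : ℂ) • w (j + 1)
          + if (j : ℕ) = 0 then 0 else (α (j - 1) : ℂ) • w (j - 1))
          - ((c : ℂ) • weighted N α w) j = (1 / 2 : ℂ) • (((α 1 - α 0 : ℝ) : ℂ) • w 1) := by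
        ext x
        simp [hj, weighted, h0]
      rw [this, l2Sq_smul]
      have h2 : ‖(1 / 2 : ℂ)‖ ^ 2 = 1 / 4 := by norm_num
      rw [h2]
      nlinarith [sq_nonneg δ]
    · obtain ⟨n, hn⟩ : ∃ n, (j : ℕ) = n + 1 := ⟨j - 1, by omega⟩
      have h1 := hterm (α (n + 2) - α (n + 1)) (hα (n + 1)) (n + 2)
      have h2 := hterm (α n - α (n + 1)) (by rw [abs_sub_comm]; exact hα n) n
      have : (1 / 2 : ℂ) • ((α (j + 1) : ℂ) • w (j + 1)
          + if (j : ℕ) = 0 then 0 else (α (j - 1) : ℂ) • w (j - 1))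
          - ((c : ℂ) • weighted N α w) j
          = (1 / 2 : ℂ) • (((α (n + 2) - α (n + 1) : ℝ) : ℂ) • w (n + 2)
            + ((α n - α (n + 1) : ℝ) : ℂ) • w n) := by
        ext x
        have hx := congrFun (hw n) x
        simp only [Pi.add_apply, Pi.smul_apply, smul_eq_mul] at hx
        simp [hn, weighted]
        linear_combination ((α (n + 1) : ℂ) / 2) * hx
      rw [this, l2Sq_smul]
      have h3 := l2Sq_add_le (((α (n + 2) - α (n + 1) : ℝ) : ℂ) • w (n + 2))
        (((α n - α (n + 1) : ℝ) : ℂ) • w n)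
      have h4 : ‖(1 / 2 : ℂ)‖ ^ 2 = 1 / 4 := by norm_num
      rw [h4]
      linarith
  calc _ ≤ ∑ _j : Fin N, 4 * δ ^ 2 := Finset.sum_le_sum fun j _ => hrow j
    _ = _ := by simp

/-- Measuring a vector that is a mean of two approximate eigenvectors, for `a` and for `-a`, in
an eigenbasis gives an eigenvalue close to `a` in absolute value. -/
lemma sum_abs_eigenvalue_sub_sq_le [Fintype K] [DecidableEq ι] {X : Matrix ι ι ℂ} (hX : X.IsHermitian) {a : ℝ} (ha : 0 ≤ a)
    (Y Z : Matrix ι K ℂ) :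
    ∑ m, (|hX.eigenvalues m| - a) ^ 2 *
        l2Sq ((((star hX.eigenvectorUnitary : unitaryGroup ι ℂ) : Matrix ι ι ℂ) * ((1 / 2 : ℂ) • (Y + Z))) m)
      ≤ (∑ m, l2Sq ((X * Y - (a : ℂ) • Y) m) + ∑ m, l2Sq ((X * Z - ((-a : ℝ) : ℂ) • Z) m)) / 2 := by
  set F : unitaryGroup ι ℂ := star hX.eigenvectorUnitary with hF
  have hFX : (F : Matrix ι ι ℂ) * X
      = diagonal (fun m => (hX.eigenvalues m : ℂ)) * (F : Matrix ι ι ℂ) := by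
    have h := hX.spectral_theorem
    rw [Unitary.conjStarAlgAut_apply] at h
    have h1 : (F : Matrix ι ι ℂ) * (hX.eigenvectorUnitary : Matrix ι ι ℂ) = 1 :=
      Unitary.coe_star_mul_self _
    conv_lhs => rw [h]
    rw [← Matrix.mul_assoc, ← Matrix.mul_assoc, h1, Matrix.one_mul]
    rfl
  have key (c : ℝ) (Y : Matrix ι K ℂ) (m : ι) :
      ((F : Matrix ι ι ℂ) * (X * Y - (c : ℂ) • Y)) m
        = ((hX.eigenvalues m - c : ℝ) : ℂ) • ((F : Matrix ι ι ℂ) * Y) m := by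
    rw [Matrix.mul_sub, ← Matrix.mul_assoc, hFX, Matrix.mul_assoc, Matrix.mul_smul]
    ext x
    simp [diagonal_mul, sub_mul]
  rw [← sum_l2Sq_mul F (X * Y - (a : ℂ) • Y), ← sum_l2Sq_mul F (X * Z - ((-a : ℝ) : ℂ) • Z),
    ← Finset.sum_add_distrib, Finset.sum_div]
  refine Finset.sum_le_sum fun m _ => ?_
  rw [key, key, l2Sq_smul, l2Sq_smul]
  have h1 : ((F : Matrix ι ι ℂ) * ((1 / 2 : ℂ) • (Y + Z))) m
      = (1 / 2 : ℂ) • (((F : Matrix ι ι ℂ) * Y) m + ((F : Matrix ι ι ℂ) * Z) m) := by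
    rw [Matrix.mul_smul, Matrix.mul_add]; rfl
  rw [h1, l2Sq_smul]
  have h2 := l2Sq_add_le (((F : Matrix ι ι ℂ) * Y) m) (((F : Matrix ι ι ℂ) * Z) m)
  have hy : 0 ≤ l2Sq (((F : Matrix ι ι ℂ) * Y) m) := Finset.sum_nonneg fun _ _ => by positivity
  have hz : 0 ≤ l2Sq (((F : Matrix ι ι ℂ) * Z) m) := Finset.sum_nonneg fun _ _ => by positivity
  -- For a ≥ 0, |λ| is at least as close to a as λ is to either of a and -a.
  have hu : (|hX.eigenvalues m| - a) ^ 2 ≤ (hX.eigenvalues m - a) ^ 2 := by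
    rcases abs_cases (hX.eigenvalues m) with ⟨h, _⟩ | ⟨h, _⟩ <;> rw [h] <;> nlinarith
  have hv : (|hX.eigenvalues m| - a) ^ 2 ≤ (hX.eigenvalues m - -a) ^ 2 := by
    rcases abs_cases (hX.eigenvalues m) with ⟨h, _⟩ | ⟨h, _⟩ <;> rw [h] <;> nlinarith
  simp only [Complex.norm_real, Real.norm_eq_abs, sq_abs]
  norm_num
  have := mul_le_mul_of_nonneg_left h2 (sq_nonneg (|hX.eigenvalues m| - a))
  have := mul_le_mul_of_nonneg_right hu hy
  have := mul_le_mul_of_nonneg_right hv hz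
  norm_num at *
  linarith

/-! ### The sine window. -/

/-- The sine window of length `2 L`. -/
def sineWindow (L : ℕ) (n : ℕ) : ℝ := Real.sin (Real.pi * n / (2 * L)) / √L

lemma sineWindow_zero (L : ℕ) : sineWindow L 0 = 0 := by simp [sineWindow]

lemma sineWindow_end {L : ℕ} (hL : 0 < L) : sineWindow L (2 * L) = 0 := by
  have : Real.pi * ((2 * L : ℕ) : ℝ) / (2 * L) = Real.pi := by
    have : (L : ℝ) ≠ 0 := by positivity
    push_cast; field_simp
  rw [sineWindow, this]; simp

lemma abs_sineWindow_sub_le {L : ℕ} (n : ℕ) :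
    |sineWindow L (n + 1) - sineWindow L n| ≤ Real.pi / (2 * L) / √L := by
  rw [sineWindow, sineWindow, ← sub_div, abs_div, abs_of_nonneg (Real.sqrt_nonneg (L : ℝ))]
  refine div_le_div_of_nonneg_right ?_ (Real.sqrt_nonneg _)
  refine (Real.abs_sin_sub_sin_le _ _).trans ?_
  rw [← sub_div, ← mul_sub]
  push_cast
  rw [add_sub_cancel_left, mul_one, abs_of_nonneg (by positivity)]

/-- Positions j and L + j differ by a quarter period, so their squares add up to (sin² + cos²)/L. -/
lemma sum_sineWindow_sq {L : ℕ} (hL : 0 < L) :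
    ∑ j : Fin (2 * L), sineWindow L j ^ 2 = 1 := by
  have hL' : (L : ℝ) ≠ 0 := by positivity
  rw [Fin.sum_univ_eq_sum_range (fun j => sineWindow L j ^ 2), two_mul, Finset.sum_range_add,
    ← Finset.sum_add_distrib]
  have (j : ℕ) : sineWindow L j ^ 2 + sineWindow L (L + j) ^ 2 = 1 / L := by
    have : Real.pi * ((L + j : ℕ) : ℝ) / (2 * L) = Real.pi * j / (2 * L) + Real.pi / 2 := by
      push_cast; field_simp; ring
    rw [sineWindow, sineWindow, this, Real.sin_add_pi_div_two, div_pow, div_pow,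
      Real.sq_sqrt (by positivity), ← add_div, Real.sin_sq_add_cos_sq]
  simp only [this]
  simp [hL']

end Analysis

/-! ### Elementary gates and their action on states. -/

section Gates

variable {ι κ : Type} [Fintype ι] [Fintype κ]

/-- Transport of a unitary matrix along an equivalence of labels. -/
def reindexUnitary [DecidableEq ι] [DecidableEq κ] (E : ι ≃ κ) (G : unitaryGroup κ ℂ) : unitaryGroup ι ℂ :=
  ⟨(G : Matrix κ κ ℂ).submatrix E E, by
    rw [mem_unitaryGroup_iff, star_eq_conjTranspose, conjTranspose_submatrix, submatrix_mul_equiv,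
      ← star_eq_conjTranspose, mem_unitaryGroup_iff.mp G.2, submatrix_one_equiv]⟩

lemma submatrix_mulVec_comp (E : ι ≃ κ) (M : Matrix κ κ ℂ) (v : κ → ℂ) :
    M.submatrix E E *ᵥ (v ∘ E) = (M *ᵥ v) ∘ E := by
  rw [submatrix_mulVec_equiv, Function.comp_assoc, Equiv.self_comp_symm, Function.comp_id]

/-- The unitary that applies `G j` when the second register holds `j`. -/
def blockUnitary [DecidableEq ι] [DecidableEq κ] (G : κ → unitaryGroup ι ℂ) : unitaryGroup (ι × κ) ℂ :=
  ⟨blockDiagonal fun j => (G j : Matrix ι ι ℂ), by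
    rw [mem_unitaryGroup_iff, star_eq_conjTranspose, blockDiagonal_conjTranspose,
      ← blockDiagonal_mul, ← blockDiagonal_one]
    congr 1
    ext1 j
    exact mem_unitaryGroup_iff.mp (G j).2⟩

lemma blockDiagonal_mulVec [DecidableEq κ] (G : κ → Matrix ι ι ℂ) (Φ : Matrix κ ι ℂ) :
    (blockDiagonal G *ᵥ fun p : ι × κ => Φ p.2 p.1) = fun p => (G p.2 *ᵥ Φ p.2) p.1 := by
  ext ⟨x, j⟩
  simp [mulVec, dotProduct, Fintype.sum_prod_type, blockDiagonal_apply]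

/-- The unitary that applies `F` to the second register. -/
def rightUnitary (ι : Type) [Fintype ι] [DecidableEq ι] [DecidableEq κ] (F : unitaryGroup κ ℂ) :
    unitaryGroup (ι × κ) ℂ :=
  ⟨(1 : Matrix ι ι ℂ) ⊗ₖ (F : Matrix κ κ ℂ), kronecker_mem_unitary (one_mem _) F.2⟩

lemma one_kronecker_mulVec [DecidableEq ι] (F : Matrix κ κ ℂ) (Y : Matrix κ ι ℂ) :
    (((1 : Matrix ι ι ℂ) ⊗ₖ F) *ᵥ fun p : ι × κ => Y p.2 p.1) = fun p => (F * Y) p.2 p.1 := by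
  ext ⟨x, j⟩
  simp [mulVec, dotProduct, Fintype.sum_prod_type, one_apply, mul_apply]

/-- The unitary of a permutation of basis labels. -/
def permUnitary [DecidableEq ι] (f : Equiv.Perm ι) : unitaryGroup ι ℂ :=
  ⟨(1 : Matrix ι ι ℂ).submatrix f (Equiv.refl ι), by
    rw [mem_unitaryGroup_iff, star_eq_conjTranspose, conjTranspose_submatrix, submatrix_mul_equiv]
    simp⟩

lemma permUnitary_mulVec [DecidableEq ι] (f : Equiv.Perm ι) (v : ι → ℂ) :
    (permUnitary f : Matrix ι ι ℂ) *ᵥ v = v ∘ f := by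
  ext x
  simp [permUnitary, mulVec, dotProduct, one_apply]

/-- The reflection fixing the basis vectors in `p` and negating the others. -/
def signUnitary [DecidableEq ι] (p : ι → Prop) [DecidablePred p] : unitaryGroup ι ℂ :=
  ⟨diagonal fun x => if p x then 1 else -1, by
    rw [mem_unitaryGroup_iff, star_eq_conjTranspose, diagonal_conjTranspose, diagonal_mul_diagonal,
      ← diagonal_one]
    congr 1
    ext x
    by_cases h : p x <;> simp [h]⟩

lemma signUnitary_mulVec_apply [DecidableEq ι] (p : ι → Prop) [DecidablePred p] (v : ι → ℂ) (x : ι) :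
    ((signUnitary p : Matrix ι ι ℂ) *ᵥ v) x = (if p x then 1 else -1) * v x := by
  simp [signUnitary, mulVec_diagonal]

lemma signUnitary_mul_self [DecidableEq ι] (p : ι → Prop) [DecidablePred p] :
    signUnitary p * signUnitary p = 1 := by
  refine Subtype.ext ?_
  change diagonal _ * diagonal _ = (1 : Matrix ι ι ℂ)
  rw [diagonal_mul_diagonal, ← diagonal_one]
  congr 1
  ext x
  by_cases h : p x <;> simp [h]

end Gates

/-! ### Circuits with a counter register and their query cost. -/

variable {k b m N : ℕ}

/-- Labels of the query register, the control qubit and a second register of the same size. -/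
abbrev Work (k b : ℕ) : Type := (Reg k b × Bool) × Reg k b

/-- The label of the start vector, with the control qubit set. -/
def startLabel (k b : ℕ) : Work k b := (((zeros k, zeros b), true), (zeros k, zeros b))

/-- The controlled operator, acting on the query register and the control qubit. -/
def ctrlUnitary (M : Oracle k b) : unitaryGroup (Work k b) ℂ :=
  ⟨controlled (M : Matrix (Reg k b) (Reg k b) ℂ) ⊗ₖ (1 : Matrix (Reg k b) (Reg k b) ℂ),
    kronecker_mem_unitary (by
      convert (blockUnitary fun c : Bool => if c then M else 1).2 using 1
      rw [controlled, blockUnitary]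
      have h : (fun c : Bool => if c then (M : Matrix (Reg k b) (Reg k b) ℂ) else 1)
          = fun c => ((if c then M else 1 : Oracle k b) : Matrix (Reg k b) (Reg k b) ℂ) := by
        ext1 c
        cases c <;> rfl
      rw [h]) (one_mem _)⟩

lemma ctrlUnitary_mul (M M' : Oracle k b) :
    ctrlUnitary (M * M') = ctrlUnitary M * ctrlUnitary M' := by
  refine Subtype.ext ?_
  change controlled _ ⊗ₖ _ = (controlled _ ⊗ₖ _) * (controlled _ ⊗ₖ _)
  rw [← mul_kronecker_mul, mul_one, controlled, controlled, controlled, ← blockDiagonal_mul]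
  congr 2
  ext1 c
  cases c <;> simp

lemma ctrlUnitary_one : ctrlUnitary (1 : Oracle k b) = 1 := by
  have h := ctrlUnitary_mul (1 : Oracle k b) 1
  rw [mul_one] at h
  exact left_eq_mul.mp h

lemma ctrlUnitary_inv (M : Oracle k b) : ctrlUnitary M⁻¹ = (ctrlUnitary M)⁻¹ := by
  rw [eq_inv_iff_mul_eq_one, ← ctrlUnitary_mul, inv_mul_cancel, ctrlUnitary_one]

/-- Split of the memory into the registers `Work` and a counter. -/
def memEquiv (e : Qubits m ≃ Reg k b × Fin N) : Memory k b m ≃ Work k b × Fin N :=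
  (Equiv.prodCongr (Equiv.refl _) e).trans (Equiv.prodAssoc _ _ _).symm

/-- The state of the memory that has as component the row `Φ j` where the counter holds `j`. -/
def memState (e : Qubits m ≃ Reg k b × Fin N) (Φ : Matrix (Fin N) (Work k b) ℂ) : Memory k b m → ℂ :=
  (fun p : Work k b × Fin N => Φ p.2 p.1) ∘ memEquiv e

/-- The state after a list of steps. -/
def run (U V : Oracle k b) (l : List (Step k b m)) (ψ : Memory k b m → ℂ) : Memory k b m → ℂ :=
  l.foldl (fun ψ s => (s.eval U V).mulVec ψ) ψ

/-- The list of steps `l` makes `c` queries and performs `T U V j` where the counter holds `j`. -/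
structure Realizes (e : Qubits m ≃ Reg k b × Fin N) (l : List (Step k b m)) (c : ℕ)
    (T : Oracle k b → Oracle k b → Fin N → unitaryGroup (Work k b) ℂ) : Prop where
  cost : (l.map Step.cost).sum = c
  run_eq : ∀ U V Φ, run U V l (memState e Φ)
    = memState e (of fun j => (T U V j : Matrix (Work k b) (Work k b) ℂ) *ᵥ Φ j)

variable {e : Qubits m ≃ Reg k b × Fin N}

lemma Realizes.append {l₁ l₂ : List (Step k b m)} {c₁ c₂ : ℕ}
    {T₁ T₂ : Oracle k b → Oracle k b → Fin N → unitaryGroup (Work k b) ℂ}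
    (h₁ : Realizes e l₁ c₁ T₁) (h₂ : Realizes e l₂ c₂ T₂) :
    Realizes e (l₁ ++ l₂) (c₁ + c₂) fun U V j => T₂ U V j * T₁ U V j := by
  constructor
  · rw [List.map_append, List.sum_append, h₁.cost, h₂.cost]
  · intro U V Φ
    have : run U V (l₁ ++ l₂) (memState e Φ) = run U V l₂ (run U V l₁ (memState e Φ)) := by
      simp [run]
    rw [this, h₁.run_eq, h₂.run_eq]
    exact congrArg (memState e) (funext fun j => mulVec_mulVec _ _ _)

lemma realizes_gate (e : Qubits m ≃ Reg k b × Fin N) (G : Fin N → unitaryGroup (Work k b) ℂ) :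
    Realizes e [.gate (reindexUnitary (memEquiv e) (blockUnitary G))] 0 fun _ _ => G := by
  refine ⟨rfl, fun U V Φ => ?_⟩
  change (blockDiagonal _).submatrix _ _ *ᵥ _ = _
  rw [memState, submatrix_mulVec_comp, blockDiagonal_mulVec]
  rfl

lemma realizes_query (e : Qubits m ≃ Reg k b × Fin N) (q : Query) :
    Realizes e [.query q] 1 fun U V _ => ctrlUnitary (q.eval U V) := by
  refine ⟨rfl, fun U V Φ => ?_⟩
  have : (controlled (q.eval U V : Matrix (Reg k b) (Reg k b) ℂ) ⊗ₖ
      (1 : Matrix (Qubits m) (Qubits m) ℂ)) = (blockDiagonal fun _ : Fin N =>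
        (ctrlUnitary (q.eval U V) : Matrix (Work k b) (Work k b) ℂ)).submatrix
          (memEquiv e) (memEquiv e) := by
    ext ⟨x, y⟩ ⟨x', y'⟩
    have hy : y = y' ↔ (e y).1 = (e y').1 ∧ (e y).2 = (e y').2 := by
      rw [← Prod.ext_iff, e.injective.eq_iff]
    by_cases h1 : (e y).1 = (e y').1 <;> by_cases h2 : (e y).2 = (e y').2 <;>
      simp [memEquiv, ctrlUnitary, blockDiagonal_apply, one_apply, hy, h1, h2]
  change (controlled _ ⊗ₖ _) *ᵥ _ = _
  rw [this, memState, submatrix_mulVec_comp, blockDiagonal_mulVec]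
  rfl

/-- Exchange of the query register and the second register. -/
def swapReg (k b : ℕ) : Equiv.Perm (Work k b) :=
  Function.Involutive.toPerm (fun x => ((x.2, x.1.2), x.1.1)) fun _ => rfl

/-- Exchange of the systems `A` of the query register and of the second register. -/
def swapSys (k b : ℕ) : Equiv.Perm (Work k b) :=
  Function.Involutive.toPerm
    (fun x => (((x.2.1, x.1.1.2), x.1.2), (x.1.1.1, x.2.2))) fun _ => rfl

/-- The unitary that prepares a state with amplitude `σ |ρ⟩` at the label zero of the query
register. -/
def prepUnitary (U V : Oracle k b) : unitaryGroup (Work k b) ℂ :=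
  ctrlUnitary V⁻¹ * (permUnitary (swapSys k b) * (ctrlUnitary V *
    (permUnitary (swapReg k b) * ctrlUnitary U)))

lemma exists_realizes_prepUnitary (e : Qubits m ≃ Reg k b × Fin N) :
    ∃ l, Realizes e l 3 fun U V _ => prepUnitary U V :=
  ⟨_, ((((realizes_query e .U).append (realizes_gate e fun _ => permUnitary (swapReg k b))).append
    (realizes_query e .V)).append (realizes_gate e fun _ => permUnitary (swapSys k b))).append
    (realizes_query e .Vinv)⟩

lemma exists_realizes_prepUnitary_inv (e : Qubits m ≃ Reg k b × Fin N) :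
    ∃ l, Realizes e l 3 fun U V _ => (prepUnitary U V)⁻¹ := by
  have h := ((((realizes_query e .V).append
    (realizes_gate e fun _ => (permUnitary (swapSys k b))⁻¹)).append
    (realizes_query e .Vinv)).append (realizes_gate e fun _ => (permUnitary (swapReg k b))⁻¹)).append
    (realizes_query e .Uinv)
  refine ⟨_, h.cost, fun U V Φ => ?_⟩
  rw [h.run_eq]
  simp only [prepUnitary, Query.eval, ctrlUnitary_inv, _root_.mul_inv_rev, mul_assoc, inv_inv]

/-- The reflection about the label zero of the query register. -/
def goodReflection (k b : ℕ) : unitaryGroup (Work k b) ℂ :=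
  signUnitary fun x => x.1.1 = (zeros k, zeros b)

/-- The reflection about the prepared state. -/
def stateReflection (U V : Oracle k b) : unitaryGroup (Work k b) ℂ :=
  prepUnitary U V * signUnitary (fun x => x = startLabel k b) * (prepUnitary U V)⁻¹

/-- The prepared state. -/
def prepState (U V : Oracle k b) : Work k b → ℂ :=
  (prepUnitary U V : Matrix (Work k b) (Work k b) ℂ) *ᵥ ket (startLabel k b)

/-- There is a circuit that prepares, in the branch where the counter holds `j`, the state
number `min j t` of the alternating orbit of the two reflections. -/
lemma exists_realizes_alternate (e : Qubits m ≃ Reg k b × Fin N) (t : ℕ) :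
    ∃ l c T, Realizes e l c T ∧ c ≤ 6 * t + 3 ∧ ∀ U V j,
      (T U V j : Matrix (Work k b) (Work k b) ℂ) *ᵥ ket (startLabel k b)
        = alternate (goodReflection k b) (stateReflection U V) (prepState U V) (min j t) := by
  obtain ⟨lA, hA⟩ := exists_realizes_prepUnitary e
  obtain ⟨lB, hB⟩ := exists_realizes_prepUnitary_inv e
  induction t with
  | zero => exact ⟨lA, 3, _, hA, le_rfl, fun U V j => by simp [alternate, prepState]⟩
  | succ t ih =>
    obtain ⟨l, c, T, h, hc, hT⟩ := ih
    have hmin (j : Fin N) : (¬ t < (j : ℕ) ∧ min (j : ℕ) (t + 1) = min (j : ℕ) t) ∨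
        (t < (j : ℕ) ∧ min (j : ℕ) (t + 1) = t + 1 ∧ min (j : ℕ) t = t) := by omega
    by_cases ht : Even t
    -- The reflection P is a fixed gate: this step makes no query.
    · refine ⟨_, _, _, h.append (realizes_gate e fun j : Fin N =>
        if t < (j : ℕ) then goodReflection k b else 1), by omega, fun U V j => ?_⟩
      rw [UnitaryGroup.mul_val, ← mulVec_mulVec, hT]
      rcases hmin j with ⟨h1, h2⟩ | ⟨h1, h2, h3⟩
      · simp [h1, h2]
      · simp [h1, h3, alternate, ht]
    -- Only the middle reflection depends on the counter; in the branches already finished, the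
    -- preparation and its inverse cancel. Hence six queries per step, with no control of the
    -- counter over the oracles.
    · refine ⟨_, _, _, h.append ((hB.append (realizes_gate e fun j : Fin N =>
        if t < (j : ℕ) then signUnitary (fun x => x = startLabel k b) else 1)).append hA),
        by omega, fun U V j => ?_⟩
      rw [UnitaryGroup.mul_val, ← mulVec_mulVec, hT]
      rcases hmin j with ⟨h1, h2⟩ | ⟨h1, h2, h3⟩
      · simp [h1, h2]
      · rw [h2, h3, alternate, if_neg ht, if_pos h1, stateReflection, mul_assoc]

/-! ### The two reflections of amplitude estimation. -/

section Reflection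

variable {ι κ : Type} [Fintype ι] [DecidableEq ι] [Fintype κ] [DecidableEq κ]

lemma l2Sq_ket (i : ι) : l2Sq (ket i) = 1 := by
  rw [l2Sq, Finset.sum_eq_single i] <;> simp +contextual [ket]

/-- With s = A|i⟩, the conjugated reflection is 2|s⟩⟨s| - 1. -/
lemma conj_signUnitary_mulVec (A : unitaryGroup ι ℂ) (i : ι) (v : ι → ℂ) :
    ((A * signUnitary (fun x => x = i) * A⁻¹ : unitaryGroup ι ℂ) : Matrix ι ι ℂ) *ᵥ v
      = (2 * (star ((A : Matrix ι ι ℂ) *ᵥ ket i) ⬝ᵥ v)) • ((A : Matrix ι ι ℂ) *ᵥ ket i) - v := by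
  set w := ((A⁻¹ : unitaryGroup ι ℂ) : Matrix ι ι ℂ) *ᵥ v with hw
  have h1 : (signUnitary (fun x => x = i) : Matrix ι ι ℂ) *ᵥ w = (2 * w i) • ket i - w := by
    ext x
    rw [signUnitary_mulVec_apply]
    by_cases h : x = i
    · subst h
      simp [ket]; ring
    · simp [ket, h]
  have h2 : w i = star ((A : Matrix ι ι ℂ) *ᵥ ket i) ⬝ᵥ v := by
    rw [star_mulVec, ← dotProduct_mulVec, hw]
    have : star (ket i : ι → ℂ) = ket i := by
      ext x
      by_cases h : x = i <;> simp [ket, h]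
    rw [this, ket, single_one_dotProduct]
    rfl
  have h3 : (A : Matrix ι ι ℂ) *ᵥ w = v := by
    rw [hw, mulVec_mulVec, ← UnitaryGroup.mul_val, mul_inv_cancel, UnitaryGroup.one_val,
      one_mulVec]
  rw [UnitaryGroup.mul_val, UnitaryGroup.mul_val, ← mulVec_mulVec, ← mulVec_mulVec, ← hw, h1,
    mulVec_sub, mulVec_smul, h3, h2]

/-- The vector `v` projected to the span of the basis vectors in `p`. -/
def restrictTo (p : ι → Prop) [DecidablePred p] (v : ι → ℂ) : ι → ℂ :=
  fun x => if p x then v x else 0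

variable (A : unitaryGroup ι ℂ) (i : ι) (p : ι → Prop) [DecidablePred p]

/-- The two reflections of amplitude estimation exchange the prepared state and its normalized
projection, up to the factor `2 a`, where `a` is the norm of the projection. -/
lemma exists_good_vector :
    ∃ l : ι → ℂ, l2Sq l ≤ 1 ∧
      (signUnitary p + (A * signUnitary (fun x => x = i) * A⁻¹ : unitaryGroup ι ℂ)
          : Matrix ι ι ℂ) *ᵥ ((A : Matrix ι ι ℂ) *ᵥ ket i)
        = (2 * √(l2Sq (restrictTo p ((A : Matrix ι ι ℂ) *ᵥ ket i))) : ℂ) • l ∧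
      (signUnitary p + (A * signUnitary (fun x => x = i) * A⁻¹ : unitaryGroup ι ℂ)
          : Matrix ι ι ℂ) *ᵥ l
        = (2 * √(l2Sq (restrictTo p ((A : Matrix ι ι ℂ) *ᵥ ket i))) : ℂ) •
          ((A : Matrix ι ι ℂ) *ᵥ ket i) := by
  set s := (A : Matrix ι ι ℂ) *ᵥ ket i with hs
  set g := restrictTo p s with hg
  set a := √(l2Sq g) with ha
  have hg0 : 0 ≤ l2Sq g := Finset.sum_nonneg fun _ _ => by positivity
  have ha2 : a * a = l2Sq g := Real.mul_self_sqrt hg0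
  have hs1 : l2Sq s = 1 := by rw [hs, l2Sq_mulVec, l2Sq_ket]
  have hss : star s ⬝ᵥ s = 1 := by rw [star_dotProduct_self, hs1]; simp
  have hsg : star s ⬝ᵥ g = (a : ℂ) * a := by
    have : star s ⬝ᵥ g = star g ⬝ᵥ g := by
      simp only [dotProduct, hg, restrictTo, Pi.star_apply]
      refine Finset.sum_congr rfl fun x _ => ?_
      split_ifs <;> simp
    rw [this, star_dotProduct_self, ← ha2]
    simp
  have hpg : (signUnitary p : Matrix ι ι ℂ) *ᵥ g = g := by
    ext x
    rw [signUnitary_mulVec_apply]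
    by_cases h : p x <;> simp [hg, restrictTo, h]
  have hps : (signUnitary p : Matrix ι ι ℂ) *ᵥ s = (2 : ℂ) • g - s := by
    ext x
    rw [signUnitary_mulVec_apply]
    by_cases h : p x <;> simp [hg, restrictTo, h]
    ring
  have hag : (a : ℂ) • ((a : ℂ)⁻¹ • g) = g := by
    by_cases h : a = 0
    · have h0 : l2Sq g = 0 := by rw [← ha2, h, zero_mul]
      have : g = 0 := by
        ext x
        have := (Finset.sum_eq_zero_iff_of_nonneg (fun _ _ => by positivity)).mp h0 x
          (Finset.mem_univ x)
        simpa using this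
      simp [this]
    · rw [smul_smul, mul_inv_cancel₀ (by exact_mod_cast h), one_smul]
  -- If a = 0 then the inverse is 0 and this vector is zero, which is why its norm is only bounded
  -- by 1.
  refine ⟨(a : ℂ)⁻¹ • g, ?_, ?_, ?_⟩
  · rw [l2Sq_smul, ← ha2, norm_inv, Complex.norm_real, Real.norm_eq_abs, inv_pow, sq_abs, sq]
    exact inv_mul_le_one
  · rw [add_mulVec, hps, conj_signUnitary_mulVec, ← hs, hss, mul_one, SemigroupAction.mul_smul, hag]
    ext x
    simp
    ring
  · rw [add_mulVec, mulVec_smul, hpg, conj_signUnitary_mulVec, ← hs, dotProduct_smul, hsg,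
      add_sub_cancel, smul_eq_mul]
    congr 2
    by_cases h : a = 0
    · simp [h]
    · rw [inv_mul_cancel_left₀ (by exact_mod_cast h)]

/-- The state `f` of two registers, with the control qubit set. -/
def embed (f : ι → κ → ℂ) : (ι × Bool) × κ → ℂ := fun x => if x.1.2 then f x.1.1 x.2 else 0

lemma controlled_kronecker_mulVec_embed (M : Matrix ι ι ℂ) (f : ι → κ → ℂ) :
    (controlled M ⊗ₖ (1 : Matrix κ κ ℂ)) *ᵥ embed f
      = embed fun r r' => (M *ᵥ fun x => f x r') r := by
  ext ⟨⟨r, c⟩, r'⟩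
  cases c <;>
    simp [mulVec, dotProduct, Fintype.sum_prod_type, controlled, embed, blockDiagonal_apply,
      one_apply]

end Reflection

/-! ### The amplitude σ|ρ⟩ of the prepared state. -/

section Amplitude

variable {k b : ℕ}

/-- The stages are |0⟩|0⟩, then |ρ⟩|0⟩, |0⟩|ρ⟩, |σ⟩|ρ⟩, the exchange of the `A` systems, and V† on
the query register. The control qubit stays set throughout. -/
lemma prepState_eq (U V : Oracle k b) :
    prepState U V = embed fun r r' =>
      (((V⁻¹ : Oracle k b) : Matrix (Reg k b) (Reg k b) ℂ) *ᵥ fun x =>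
        ((V : Matrix (Reg k b) (Reg k b) ℂ) *ᵥ ket (zeros k, zeros b)) (r'.1, x.2) *
        ((U : Matrix (Reg k b) (Reg k b) ℂ) *ᵥ ket (zeros k, zeros b)) (x.1, r'.2)) r := by
  have h0 : (ket (startLabel k b) : Work k b → ℂ)
      = embed fun r r' => ket (zeros k, zeros b) r' * ket (zeros k, zeros b) r := by
    ext ⟨⟨r, c⟩, r'⟩
    simp only [ket, startLabel, embed, Pi.single_apply]
    cases c <;> by_cases h : r = (zeros k, zeros b) <;>
      by_cases h' : r' = (zeros k, zeros b) <;> simp [h, h']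
  have hc (M : Oracle k b) (f : Reg k b → Reg k b → ℂ) :
      (ctrlUnitary M : Matrix (Work k b) (Work k b) ℂ) *ᵥ embed f
        = embed fun r r' => ((M : Matrix (Reg k b) (Reg k b) ℂ) *ᵥ fun x => f x r') r :=
    controlled_kronecker_mulVec_embed _ f
  have hmul (M : Matrix (Reg k b) (Reg k b) ℂ) (v : Reg k b → ℂ) (c : ℂ) :
      (M *ᵥ fun x => c * v x) = fun x => (M *ᵥ v) x * c := by
    ext x
    simp only [mulVec, dotProduct, Finset.sum_mul]
    exact Finset.sum_congr rfl fun _ _ => by ring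
  have h1 (f : Reg k b → Reg k b → ℂ) :
      embed f ∘ swapReg k b = embed fun r r' => f r' r := rfl
  have h2 (f : Reg k b → Reg k b → ℂ) :
      embed f ∘ swapSys k b = embed fun r r' => f (r'.1, r.2) (r.1, r'.2) := rfl
  rw [prepState, prepUnitary]
  simp only [UnitaryGroup.mul_val, ← mulVec_mulVec, permUnitary_mulVec]
  rw [h0, hc]
  simp only [hmul]
  rw [h1, hc]
  simp only [hmul]
  rw [h2, hc]

lemma partialTrace_outer (u : Reg k b → ℂ) :
    partialTrace (outer u) = (of fun a x => u (a, x)) * (of fun a x => u (a, x))ᴴ := by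
  ext a a'
  simp [partialTrace, outer, vecMulVec_apply, mul_apply]

/-- Row zero of V† is ⟨σ|. Contracting it with the exchanged state sums out the `B` part of |σ⟩ and
leaves the matrix σ applied to |ρ⟩, here `W`; then tr(W W†) = tr(σρσ). -/
lemma l2Sq_restrictTo_prepState {U V : Oracle k b} {ρ σ : Matrix (Qubits k) (Qubits k) ℂ}
    (hρ : PreparesPurification U ρ) (hσ : PreparesPurification V σ) :
    l2Sq (restrictTo (fun x : Work k b => x.1.1 = (zeros k, zeros b)) (prepState U V))
      = (ρ * σ ^ 2).trace.re := by
  set u := (U : Matrix (Reg k b) (Reg k b) ℂ) *ᵥ ket (zeros k, zeros b) with hu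
  set v := (V : Matrix (Reg k b) (Reg k b) ℂ) *ᵥ ket (zeros k, zeros b) with hv
  have hρ' : ρ = _ := hρ.trans (partialTrace_outer u)
  have hσ' : σ = _ := hσ.trans (partialTrace_outer v)
  have hσH : σᴴ = σ := by
    rw [hσ', conjTranspose_mul, conjTranspose_conjTranspose]
  set W : Matrix (Qubits k) (Qubits b) ℂ := σ * of fun a x => u (a, x) with hW
  have hamp (r' : Reg k b) :
      (((V⁻¹ : Oracle k b) : Matrix (Reg k b) (Reg k b) ℂ) *ᵥ fun x =>
        v (r'.1, x.2) * u (x.1, r'.2)) (zeros k, zeros b) = W r'.1 r'.2 := by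
    have hV (x : Reg k b) : ((V⁻¹ : Oracle k b) : Matrix (Reg k b) (Reg k b) ℂ)
        (zeros k, zeros b) x = star (v x) := by
      rw [hv, ket, mulVec_single_one]
      rfl
    simp only [mulVec, dotProduct, hV, hW, hσ', mul_apply, Fintype.sum_prod_type,
      Finset.sum_mul, conjTranspose_apply, of_apply]
    refine Finset.sum_congr rfl fun a _ => Finset.sum_congr rfl fun x _ => ?_
    ring
  have h1 : l2Sq (restrictTo (fun x : Work k b => x.1.1 = (zeros k, zeros b)) (prepState U V))
      = ∑ a, ∑ x, ‖W a x‖ ^ 2 := by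
    rw [l2Sq, prepState_eq, Fintype.sum_prod_type, Fintype.sum_prod_type,
      Finset.sum_eq_single (zeros k, zeros b), Finset.sum_comm, Fintype.sum_prod_type]
    · simp only [restrictTo, embed, ← hu, ← hv]
      simp
      refine Finset.sum_congr rfl fun a _ => Finset.sum_congr rfl fun x _ => ?_
      rw [← hamp (a, x)]
      rfl
    · intro r _ hr
      simp [restrictTo, hr]
    · simp
  have h2 : ((∑ a, ∑ x, ‖W a x‖ ^ 2 : ℝ) : ℂ) = (W * Wᴴ).trace := by
    simp [trace, mul_apply, Complex.mul_conj']
  have h3 : (W * Wᴴ).trace = (ρ * σ ^ 2).trace := by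
    rw [hW, conjTranspose_mul, hσH, Matrix.mul_assoc, ← Matrix.mul_assoc (of _), ← hρ',
      trace_mul_comm, Matrix.mul_assoc, sq]
  rw [h1, ← h3, ← h2, Complex.ofReal_re]

end Amplitude

/-! ### The amplitude estimation algorithm and its error. -/

section Estimator

variable {k b m N : ℕ}

lemma sum_norm_memState_sq (e : Qubits m ≃ Reg k b × Fin N) (Φ : Matrix (Fin N) (Work k b) ℂ) :
    ∑ y, ‖memState e Φ y‖ ^ 2 = ∑ j, l2Sq (Φ j) := by
  refine (Equiv.sum_comp (memEquiv e) fun p : Work k b × Fin N => ‖Φ p.2 p.1‖ ^ 2).trans ?_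
  rw [Fintype.sum_prod_type_right]
  rfl

lemma sum_l2Sq_weighted (α : ℕ → ℝ) (w : ℕ → Work k b → ℂ) (hw : ∀ n, l2Sq (w n) = 1) :
    ∑ j, l2Sq (weighted N α w j) = ∑ j : Fin N, α j ^ 2 := by
  refine Finset.sum_congr rfl fun j _ => ?_
  rw [weighted, l2Sq_smul, hw, mul_one, Complex.norm_real, Real.norm_eq_abs, sq_abs]

/-- Quantum amplitude estimation. -/
lemma exists_estimator {L : ℕ} (hL : 0 < L) (e : Qubits m ≃ Reg k b × Fin (2 * L)) :
    ∃ 𝒜 : QueryAlgorithm k b, 𝒜.queryCount ≤ 6 * (2 * L) + 3 ∧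
      ∀ (U V : Oracle k b) (ε : ℝ), 0 < ε →
        1 - 2 * Real.pi ^ 2 / L ^ 2 / ε ^ 2 ≤ 𝒜.prob U V {x | |x - √(l2Sq (restrictTo
          (fun x : Work k b => x.1.1 = (zeros k, zeros b)) (prepState U V)))| < ε} := by
  set N := 2 * L with hN
  have hX := halfPath_isHermitian N
  obtain ⟨l, c, T, h, hc, hT⟩ := exists_realizes_alternate e N
  set F : unitaryGroup (Fin N) ℂ := star hX.eigenvectorUnitary with hF
  set α := sineWindow L with hα
  have hα1 : ∑ j : Fin N, α j ^ 2 = 1 := sum_sineWindow_sq hL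
  -- The initial superposition is independent of the oracles, so one fixed gate prepares it, setting
  -- the control qubit as well.
  obtain ⟨G, hG⟩ := exists_unitary_mulVec_ket (((zeros k, zeros b), false), zeros m)
    (memState e (weighted N α fun _ => ket (startLabel k b))) (by
      rw [l2Sq, sum_norm_memState_sq, sum_l2Sq_weighted _ _ fun _ => l2Sq_ket _, hα1])
  let 𝒜 : QueryAlgorithm k b :=
    ⟨m, .gate G :: (l ++ [.gate (reindexUnitary (memEquiv e) (rightUnitary (Work k b) F))]),
      fun y => |hX.eigenvalues (memEquiv e y).2|⟩
  refine ⟨𝒜, ?_, fun U V ε hε => ?_⟩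
  · simpa [QueryAlgorithm.queryCount, 𝒜, Step.cost, h.cost] using hc
  set P := goodReflection k b with hP
  set B := stateReflection U V with hB
  set s := prepState U V with hs
  set a := √(l2Sq (restrictTo (fun x : Work k b => x.1.1 = (zeros k, zeros b)) s)) with ha
  have ha0 : 0 ≤ a := Real.sqrt_nonneg _
  have hs1 : l2Sq s = 1 := by rw [hs, prepState, l2Sq_mulVec, l2Sq_ket]
  set χ := alternate P B s with hχ
  have hfinal : 𝒜.finalState U V
      = memState e ((F : Matrix (Fin N) (Fin N) ℂ) * weighted N α χ) := by
    have h1 : 𝒜.finalState U V = ((reindexUnitary (memEquiv e) (rightUnitary (Work k b) F) :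
        unitaryGroup (Memory k b m) ℂ) : Matrix (Memory k b m) (Memory k b m) ℂ) *ᵥ
        run U V l ((G : Matrix (Memory k b m) (Memory k b m) ℂ) *ᵥ
          ket (((zeros k, zeros b), false), zeros m)) := by
      simp [QueryAlgorithm.finalState, 𝒜, run, Step.eval]
    have h2 : (of fun j => (T U V j : Matrix (Work k b) (Work k b) ℂ) *ᵥ
        weighted N α (fun _ => ket (startLabel k b)) j) = weighted N α χ := by
      refine funext fun j => ?_
      change (T U V j : Matrix (Work k b) (Work k b) ℂ) *ᵥ ((α j : ℂ) • ket (startLabel k b))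
        = (α j : ℂ) • χ j
      rw [mulVec_smul, hT, min_eq_left j.2.le]
    rw [h1, hG, h.run_eq, h2]
    change (_ ⊗ₖ _).submatrix _ _ *ᵥ _ = _
    rw [memState, submatrix_mulVec_comp, one_kronecker_mulVec]
    rfl
  obtain ⟨v, hv1, hsv, hvs⟩ := exists_good_vector (prepUnitary U V) (startLabel k b)
    (fun x : Work k b => x.1.1 = (zeros k, zeros b))
  have hPP : P * P = 1 := signUnitary_mul_self _
  have hBB : B * B = 1 := by
    have h1 := signUnitary_mul_self fun x => x = startLabel k b
    have h2 (x y : unitaryGroup (Work k b) ℂ) :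
        x * y * x⁻¹ * (x * y * x⁻¹) = x * (y * y) * x⁻¹ := by group
    rw [hB, stateReflection, h2, h1, mul_one, mul_inv_cancel]
  set ξ := alternate B P v with hξ
  set w : ℝ → ℕ → Work k b → ℂ := fun t n => χ n + (t : ℂ) • ξ n with hw
  have hwb (t : ℝ) (ht : t * t = 1) (n : ℕ) : l2Sq (w t n) ≤ 4 := by
    have h1 := l2Sq_add_le (χ n) ((t : ℂ) • ξ n)
    have h2 : ‖(t : ℂ)‖ ^ 2 = 1 := by
      rw [Complex.norm_real, Real.norm_eq_abs, sq_abs, sq, ht]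
    rw [l2Sq_smul, h2, hχ, hξ, l2Sq_alternate, l2Sq_alternate, hs1] at h1
    linarith
  have hstep (t : ℝ) (ht : t * t = 1) := sum_l2Sq_halfPath_sub_le (N := N) (sineWindow_zero L)
    (sineWindow_end hL) abs_sineWindow_sub_le
    (fun n => alternate_three_term (t := t) hPP hBB hsv hvs ht n) (hwb t ht)
  have hbound : (N : ℝ) * (4 * (Real.pi / (2 * L) / √L) ^ 2) = 2 * Real.pi ^ 2 / L ^ 2 := by
    have : (L : ℝ) ≠ 0 := by positivity
    rw [div_pow, Real.sq_sqrt (by positivity), hN]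
    push_cast
    field_simp
    ring
  -- The ξ parts cancel, so the circuit need only prepare the orbit of s; the vector l is never
  -- constructed.
  have hmean : weighted N α χ
      = (1 / 2 : ℂ) • (weighted N α (w 1) + weighted N α (w (-1))) := by
    ext j x
    simp [weighted, hw]
    ring
  have hmoment : ∑ j, (|hX.eigenvalues j| - a) ^ 2 *
      l2Sq (((F : Matrix (Fin N) (Fin N) ℂ) * weighted N α χ) j) ≤ 2 * Real.pi ^ 2 / L ^ 2 := by
    have hsa : (prepUnitary U V : Matrix (Work k b) (Work k b) ℂ) *ᵥ ket (startLabel k b) = s :=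
      rfl
    have h1 := sum_abs_eigenvalue_sub_sq_le hX ha0 (weighted N α (w 1)) (weighted N α (w (-1)))
    have h2 := hstep 1 (by norm_num)
    have h3 := hstep (-1) (by norm_num)
    rw [hbound, hsa] at h2 h3
    rw [one_mul] at h2
    rw [neg_one_mul] at h3
    rw [← hmean] at h1
    linarith
  have htotal : ∑ j, l2Sq (((F : Matrix (Fin N) (Fin N) ℂ) * weighted N α χ) j) = 1 := by
    rw [sum_l2Sq_mul, sum_l2Sq_weighted _ _ fun n => (l2Sq_alternate _ _ _ _).trans hs1, hα1]
  have hprob : 𝒜.prob U V {x | |x - a| < ε}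
      = ∑ j, if |(|hX.eigenvalues j| - a)| < ε then
          l2Sq (((F : Matrix (Fin N) (Fin N) ℂ) * weighted N α χ) j) else 0 := by
    let f : Work k b × Fin N → ℝ := fun p => if |(|hX.eigenvalues p.2| - a)| < ε then
      ‖((F : Matrix (Fin N) (Fin N) ℂ) * weighted N α χ) p.2 p.1‖ ^ 2 else 0
    have h1 : 𝒜.prob U V {x | |x - a| < ε} = ∑ y, f (memEquiv e y) := by
      rw [QueryAlgorithm.prob, hfinal]
      refine Finset.sum_congr rfl fun y _ => ?_
      classical
      rw [Set.indicator_apply]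
      exact if_congr Iff.rfl rfl rfl
    rw [h1, Equiv.sum_comp (memEquiv e) f, Fintype.sum_prod_type_right]
    refine Finset.sum_congr rfl fun j _ => ?_
    by_cases hj : |(|hX.eigenvalues j| - a)| < ε <;> simp [f, hj, l2Sq]
  rw [hprob]
  -- Chebyshev's inequality: an outcome at distance at least ε contributes at least ε² times its
  -- probability to the second moment.
  calc 1 - 2 * Real.pi ^ 2 / L ^ 2 / ε ^ 2
      ≤ ∑ j, (l2Sq (((F : Matrix (Fin N) (Fin N) ℂ) * weighted N α χ) j)
          - (|hX.eigenvalues j| - a) ^ 2 *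
            l2Sq (((F : Matrix (Fin N) (Fin N) ℂ) * weighted N α χ) j) / ε ^ 2) := by
        rw [Finset.sum_sub_distrib, htotal, ← Finset.sum_div]
        gcongr
    _ ≤ _ := Finset.sum_le_sum fun j _ => by
        have h0 : 0 ≤ l2Sq (((F : Matrix (Fin N) (Fin N) ℂ) * weighted N α χ) j) :=
          Finset.sum_nonneg fun _ _ => by positivity
        split_ifs with hj
        · rw [sub_le_self_iff]
          positivity
        · rw [sub_nonpos, le_div_iff₀ (by positivity), mul_comm]
          refine mul_le_mul_of_nonneg_right ?_ h0
          rw [← sq_abs (|hX.eigenvalues j| - a)]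
          have := not_lt.mp hj
          gcongr

end Estimator

end QueryModel

end

/-! ### Choice of the window length and conclusion. -/

theorem theorem4p4 :
    ∃ C : ℝ, 0 < C ∧
      ∀ (k n : ℕ) (_ : k ≤ n) (ε : ℝ) (_ : 0 < ε) (_ : ε < 1),
        ∃ 𝒜 : QueryModel.QueryAlgorithm k (n - k),
          (𝒜.queryCount : ℝ) ≤ C / ε ∧
          ∀ (U V : QueryModel.Oracle k (n - k))
            (ρ σ : Matrix (QueryModel.Qubits k) (QueryModel.Qubits k) ℂ),
            QueryModel.PreparesPurification U ρ →
            QueryModel.PreparesPurification V σ →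
            2 / 3 ≤ 𝒜.prob U V {x : ℝ | |x - √((ρ * σ ^ 2).trace.re)| < ε} := by
  -- With L = 2^(q+1) and 2^q ≤ 8/ε, the cost 12L + 3 = 24·2^q + 3 is at most 192/ε + 3/ε.
  refine ⟨195, by norm_num, fun k n _ ε hε hε1 => ?_⟩
  obtain ⟨q, hq1, hq2⟩ := exists_nat_pow_near (x := 8 / ε) (y := 2)
    (by rw [le_div_iff₀ hε]; linarith) (by norm_num)
  -- The work qubits hold the second register and a counter of q + 2 qubits; a power of two makes
  -- them fit exactly.
  have hcard : Fintype.card (QueryModel.Qubits (k + (n - k) + (q + 2)))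
      = Fintype.card (QueryModel.Reg k (n - k) × Fin (2 * 2 ^ (q + 1))) := by
    simp [pow_add]
    ring
  obtain ⟨𝒜, hcost, hprob⟩ := QueryModel.exists_estimator (L := 2 ^ (q + 1)) (by positivity)
    (Fintype.equivOfCardEq hcard)
  refine ⟨𝒜, ?_, fun U V ρ σ hρ hσ => ?_⟩
  · have h1 : (𝒜.queryCount : ℝ) ≤ 24 * 2 ^ q + 3 := by
      have : 𝒜.queryCount ≤ 24 * 2 ^ q + 3 := hcost.trans (by rw [pow_succ]; omega)
      exact_mod_cast this
    refine h1.trans ?_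
    rw [le_div_iff₀ hε] at hq1 ⊢
    nlinarith
  · have h := hprob U V ε hε
    rw [QueryModel.l2Sq_restrictTo_prepState hρ hσ] at h
    refine le_trans ?_ h
    rw [div_lt_iff₀ hε] at hq2
    push_cast
    have hpi : Real.pi ^ 2 ≤ 10 := by nlinarith [Real.pi_lt_d2, Real.pi_pos]
    have h8 : (8 : ℝ) ^ 2 ≤ (2 ^ (q + 1)) ^ 2 * ε ^ 2 := by
      rw [← mul_pow]
      gcongr
    -- Since Lε ≥ 8 and π² ≤ 10, the failure probability is at most 20/64 < 1/3.
    have : 2 * Real.pi ^ 2 / (2 ^ (q + 1)) ^ 2 / ε ^ 2 ≤ 1 / 3 := by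
      rw [div_div, div_le_iff₀ (by positivity)]
      linarith
    linarith
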